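/- All graphs are finite, undirected and simple. A graph is rigid if the identity is its only endomorphism; a family of rigid graphs is mutually rigid if there is no homomorphism between any two different members of the family; the odd girth of a graph is the length of its shortest odd cycle. Theorem: for every integer $d\ge 3$ and every odd integer $g\ge 7$ there exists an infinite family of mutually rigid $d$-regular graphs of odd girth $g$. -/

import Mathlib

/-- The odd girth of a graph: the length of a shortest odd cycle, and `⊤` if there is no odd cycle
(so `G.oddGirth = (g : ℕ∞)` with `g : ℕ` says that the shortest odd cycles of `G` exist and have
length `g`). -/
noncomputable def SimpleGraph.oddGirth {V : Type*} (G : SimpleGraph V) : ℕ∞ :=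
  ⨅ (a : V) (w : G.Walk a a) (_ : w.IsCycle ∧ Odd w.length), (w.length : ℕ∞)

/-- A graph is rigid if the identity is its only endomorphism. -/
def SimpleGraph.IsRigid {V : Type*} (G : SimpleGraph V) : Prop :=
  ∀ f : G →g G, f = SimpleGraph.Hom.id

/-- A family of graphs is mutually rigid if each member is rigid and there are no homomorphisms
between different members. -/
def SimpleGraph.MutuallyRigid {ι : Type*} {V : ι → Type*} (G : ∀ i, SimpleGraph (V i)) : Prop :=
  (∀ i, (G i).IsRigid) ∧ ∀ i j, i ≠ j → IsEmpty (G i →g G j)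

/-!
For `D = d - 1`, `g = 2 * k + 3` and `P = k * D`, let `K` be the circular clique on `n = 2 * P + D +
2` vertices of the circle, in which `x` is joined to the `D + 1` vertices nearest to its antipode.
It is `d`-regular of odd girth `g`, and it is extremal: adding an edge or identifying two vertices
creates a shorter odd closed walk. This survives the deletion of two suitable "marked" edges
(`exists_unmarkedClique_walk_even`, `exists_unmarkedClique_walk_odd`), so a homomorphism from `K`
without the marked edges to `K` is the restriction of an automorphism of `K`, hence of a rotation or
reflection of the circle (`unmarkedClique_hom_eq_iso`, `circularClique_iso_eq`).

The graphs of the family are finite covers of `K`, given by voltages: permutations `σ` and `τ` of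
the index set of the sheets on the two marked edges, the identity on all other edges. Covers of `K`
are `d`-regular and have no odd closed walks shorter than `g`. A homomorphism `f` between two such
covers restricts on each sheet, after projection to `K`, to an automorphism `γ` of `K`. If `σ` and
`τ` have no fixed points, then `γ` preserves the marked edges: otherwise some 4-cycle through a
marked edge would lift to a closed walk in the cover although its voltage is fixed-point-free
(`isMarkedImage_of_section`). It follows that `f` maps sheets to sheets and that `γ` is the same on
all sheets, so `f` is `γ` together with a map `φ` of index sets which intertwines the permutations
up to swapping or inverting them (`markedLift_hom_eq`).

It remains to choose permutations of `N` points such that these twisted intertwiners are identities.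
With `σ` the cyclic rotation and `τ` the permutation rotating separately three consecutive segments
of lengths `2`, `3` and `N - 5`, where `N ≥ 9`, orbit lengths force this
(`not_equivariant_segmentRotate_finRotate`, `not_equivariant_finRotate_inv`, `equivariant_eq`), and
different `N` admit no intertwiners at all.
-/

namespace SimpleGraph

/-! ### Odd girth and regularity -/

/-- In a graph without odd closed walks of length less than `g`, the closed walks that are cut out
of a walk of length less than `g` when it is reduced to a path are all even. -/
theorem Walk.even_length_bypass_iff {V : Type*} [DecidableEq V] {G : SimpleGraph V} {g : ℕ}
    (hG : ∀ (v : V) (w : G.Walk v v), Odd w.length → g ≤ w.length) {u v : V} (p : G.Walk u v)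
    (hp : p.length < g) : Even p.bypass.length ↔ Even p.length := by
  induction p with
  | nil => rfl
  | @cons u w v h p ih =>
    rw [Walk.length_cons] at hp
    have ih := ih (by omega)
    simp only [Walk.bypass]
    split_ifs with hs
    · have hlen := congrArg Walk.length (p.bypass.take_spec hs)
      rw [Walk.length_append] at hlen
      have hle := p.length_bypass_le_length
      have hodd : ¬ Odd (Walk.cons h (p.bypass.takeUntil u hs)).length := fun ho => by
        have := hG u _ ho
        rw [Walk.length_cons] at this
        omega
      rw [Walk.length_cons] at hodd ⊢
      grind
    · rw [Walk.length_cons, Walk.length_cons]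
      grind

/-- The odd girth may be computed with closed walks in place of cycles. -/
theorem oddGirth_eq_of_closedWalk {V : Type*} {G : SimpleGraph V} {g : ℕ} (hodd : Odd g)
    (hG : ∀ (v : V) (w : G.Walk v v), Odd w.length → g ≤ w.length) {v : V} (w : G.Walk v v)
    (hw : w.length = g) : G.oddGirth = g := by
  classical
  refine le_antisymm ?_ ?_
  · cases w with
    | nil => exact absurd (hw ▸ hodd) (by simp)
    | @cons _ u _ h p =>
      rw [Walk.length_cons] at hw
      have hpar := p.even_length_bypass_iff hG (by omega)
      have hle := p.length_bypass_le_length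
      have hco : Odd (Walk.cons h p.bypass).length := by
        rw [Walk.length_cons]; grind
      have hge := hG v _ hco
      have hcy : (Walk.cons h p.bypass).IsCycle := by
        rw [Walk.cons_isCycle_iff]
        refine ⟨p.bypass_isPath, fun hmem => ?_⟩
        have h1 : p.bypass.length = 1 := by
          apply p.bypass_isPath.length_eq_one_of_mem_edges
          rwa [Sym2.eq_swap]
        rw [Walk.length_cons, h1] at hco
        exact absurd hco (by decide)
      refine (iInf₂_le_of_le v _ (iInf_le _ ⟨hcy, hco⟩)).trans ?_
      rw [Walk.length_cons]
      exact_mod_cast by omega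
  · refine le_iInf fun a => le_iInf fun c => le_iInf fun hc => ?_
    exact_mod_cast hG a c hc.2

theorem isRegularOfDegree_iff_natCard {V : Type*} {G : SimpleGraph V} [G.LocallyFinite] {d : ℕ} :
    G.IsRegularOfDegree d ↔ ∀ v, Nat.card (G.neighborSet v) = d := by
  simp only [IsRegularOfDegree, Nat.card_eq_fintype_card, card_neighborSet_eq_degree]

/-! ### Derived graphs of voltage assignments -/

/-- The derived graph of a voltage assignment on `K`: the dart from `x` to `y` carries the
permutation `v x y` of the index set `I`, reverse darts carry inverse permutations, and `(i, x)` is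
joined to `(v x y i, y)` for every dart. Voltages of non-adjacent pairs play no role. -/
def voltageLift {I X : Type*} (K : SimpleGraph X) (v : X → X → Equiv.Perm I)
    (hv : ∀ x y, v y x = (v x y)⁻¹) : SimpleGraph (I × X) where
  Adj p q := K.Adj p.2 q.2 ∧ q.1 = v p.2 q.2 p.1
  symm := ⟨fun p q h => ⟨h.1.symm, by rw [hv p.2 q.2, h.2]; simp⟩⟩
  loopless := ⟨fun p h => K.loopless.irrefl _ h.1⟩

/-- The covering projection of a derived graph onto its base. -/
def voltageLiftProj {I X : Type*} (K : SimpleGraph X) (v : X → X → Equiv.Perm I)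
    (hv : ∀ x y, v y x = (v x y)⁻¹) : K.voltageLift v hv →g K where
  toFun := Prod.snd
  map_rel' h := h.1

/-- The covering projection is bijective on neighbourhoods. -/
def voltageLiftNeighborEquiv {I X : Type*} (K : SimpleGraph X) (v : X → X → Equiv.Perm I)
    (hv : ∀ x y, v y x = (v x y)⁻¹) (p : I × X) :
    (K.voltageLift v hv).neighborSet p ≃ K.neighborSet p.2 where
  toFun q := ⟨q.1.2, q.2.1⟩
  invFun y := ⟨(v p.2 y.1 p.1, y.1), y.2, rfl⟩
  left_inv q := Subtype.ext (Prod.ext q.2.2.symm rfl)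
  right_inv _ := rfl

/-! ### The circular clique and its marked edges -/

/-- The circular clique on `n = 2 * P + D + 2` vertices in which two vertices are adjacent when
their difference modulo `n` lies in the interval from `P + 1` to `P + D + 1`. The interval is
symmetric under `r ↦ n - r`, so adjacency can be read off from the difference of the
representatives in `{0, …, n - 1}`. The relevant parameters are `2 ≤ D` and `P = k * D` with
`2 ≤ k`. -/
def circularClique (P D : ℕ) : SimpleGraph (Fin (2 * P + D + 2)) where
  Adj x y := ((x : ℕ) + P + 1 ≤ y ∧ (y : ℕ) ≤ x + P + D + 1) ∨
    ((y : ℕ) + P + 1 ≤ x ∧ (x : ℕ) ≤ y + P + D + 1)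
  symm := ⟨fun _ _ h => h.symm⟩
  loopless := ⟨fun x h => by omega⟩

/-- The two marked edges `{0, P + 2}` and `{D, D + P + 2}` of the circular clique. -/
def IsMarkedEdge (P D x y : ℕ) : Prop :=
  (x = 0 ∧ y = P + 2) ∨ (x = P + 2 ∧ y = 0) ∨ (x = D ∧ y = D + P + 2) ∨ (x = D + P + 2 ∧ y = D)

theorem isMarkedEdge_comm {P D x y : ℕ} : IsMarkedEdge P D x y ↔ IsMarkedEdge P D y x := by
  unfold IsMarkedEdge; tauto

/-- The circular clique without its two marked edges. -/
def unmarkedClique (P D : ℕ) : SimpleGraph (Fin (2 * P + D + 2)) where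
  Adj x y := (circularClique P D).Adj x y ∧ ¬ IsMarkedEdge P D x y
  symm := ⟨fun _ _ h => ⟨h.1.symm, fun h' => h.2 (isMarkedEdge_comm.1 h')⟩⟩
  loopless := ⟨fun x h => (circularClique P D).loopless.irrefl x h.1⟩

variable {P D : ℕ}

theorem exists_fin_val_eq_add {n : ℕ} (x : Fin n) {r : ℕ} (hr : r ≤ n) :
    ∃ z : Fin n, (z : ℕ) = x + r ∨ (z : ℕ) + n = x + r := by
  by_cases hc : (x : ℕ) + r < n
  · exact ⟨⟨_, hc⟩, Or.inl rfl⟩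
  · exact ⟨⟨x + r - n, by omega⟩, Or.inr (by simp only; omega)⟩

/-- Two steps along unmarked edges can advance by any amount from `0` to `D`. -/
theorem exists_unmarkedClique_adj_adj (hD : 2 ≤ D) (hP : 2 * D ≤ P) (x y : Fin (2 * P + D + 2))
    {r : ℕ} (hr : r ≤ D) (h : (y : ℕ) = x + r ∨ (y : ℕ) + (2 * P + D + 2) = x + r) :
    ∃ z, (unmarkedClique P D).Adj x z ∧ (unmarkedClique P D).Adj z y := by
  obtain ⟨z₁, h₁⟩ := exists_fin_val_eq_add x (r := P + 1 + D) (by omega)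
  obtain ⟨z₂, h₂⟩ := exists_fin_val_eq_add x (r := P + 1 + r) (by omega)
  have hx := x.2
  have hy := y.2
  -- `z₁` and `z₂` are the two extreme common neighbours of `x` and `y`; the marked edges cannot
  -- block both.
  have a₁ : (circularClique P D).Adj x z₁ := by simp only [circularClique]; omega
  have a₂ : (circularClique P D).Adj x z₂ := by simp only [circularClique]; omega
  have b₁ : (circularClique P D).Adj z₁ y := by simp only [circularClique]; omega
  have b₂ : (circularClique P D).Adj z₂ y := by simp only [circularClique]; omega
  have c₁ : ¬ IsMarkedEdge P D x z₁ := by unfold IsMarkedEdge; omega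
  have c₂ : ¬ IsMarkedEdge P D z₂ y := by unfold IsMarkedEdge; omega
  by_cases hc : IsMarkedEdge P D z₁ y
  · refine ⟨z₂, ⟨a₂, ?_⟩, b₂, c₂⟩
    unfold IsMarkedEdge at hc ⊢
    omega
  · exact ⟨z₁, ⟨a₁, c₁⟩, b₁, hc⟩

theorem exists_unmarkedClique_walk_of_le (hD : 2 ≤ D) (hP : 2 * D ≤ P) (m : ℕ) :
    ∀ (x y : Fin (2 * P + D + 2)) {t : ℕ} (_ : t ≤ m * D) (_ : t ≤ P)
      (_ : (y : ℕ) = x + t ∨ (y : ℕ) + (2 * P + D + 2) = x + t),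
      ∃ w : (unmarkedClique P D).Walk x y, w.length = 2 * m := by
  induction m with
  | zero =>
    intro x y t ht _ h
    obtain rfl : x = y := by ext; omega
    exact ⟨.nil, rfl⟩
  | succ m ih =>
    intro x y t ht htP h
    rw [Nat.succ_mul] at ht
    have hx := x.2
    have hy := y.2
    obtain ⟨s, r, hs, hr, rfl⟩ : ∃ s r, s ≤ m * D ∧ r ≤ D ∧ t = s + r :=
      ⟨t - min t D, min t D, by omega, by omega, by omega⟩
    obtain ⟨z, hz⟩ := exists_fin_val_eq_add x (r := r) (by omega)
    obtain ⟨u, hxu, huz⟩ := exists_unmarkedClique_adj_adj hD hP x z hr hz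
    obtain ⟨w, hw⟩ := ih z y (t := s) hs (by omega) (by omega)
    exact ⟨.cons hxu (.cons huz w), by simp only [Walk.length_cons]; omega⟩

/-- Adding an edge to the circular clique creates an odd cycle of length at most `2 * k + 1`, even
when the marked edges are deleted. -/
theorem exists_unmarkedClique_walk_even {k : ℕ} (hD : 2 ≤ D) (hP : 2 * D ≤ P) (hk : P = k * D)
    {x y : Fin (2 * P + D + 2)} (h : ¬ (circularClique P D).Adj x y) :
    ∃ w : (unmarkedClique P D).Walk x y, w.length = 2 * k := by
  simp only [circularClique] at h
  have hx := x.2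
  have hy := y.2
  have key : (∃ t ≤ P, (y : ℕ) = x + t ∨ (y : ℕ) + (2 * P + D + 2) = x + t) ∨
      (∃ t ≤ P, (x : ℕ) = y + t ∨ (x : ℕ) + (2 * P + D + 2) = y + t) := by
    by_cases h1 : (x : ℕ) ≤ y
    · by_cases h2 : (y : ℕ) ≤ x + P
      · exact Or.inl ⟨y - x, by omega, by omega⟩
      · exact Or.inr ⟨x + (2 * P + D + 2) - y, by omega, by omega⟩
    · by_cases h2 : (x : ℕ) ≤ y + P
      · exact Or.inr ⟨x - y, by omega, by omega⟩
      · exact Or.inl ⟨y + (2 * P + D + 2) - x, by omega, by omega⟩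
  rcases key with ⟨t, ht, h⟩ | ⟨t, ht, h⟩
  · exact exists_unmarkedClique_walk_of_le hD hP k x y (hk ▸ ht) ht h
  · obtain ⟨w, hw⟩ := exists_unmarkedClique_walk_of_le hD hP k y x (hk ▸ ht) ht h
    exact ⟨w.reverse, by rw [Walk.length_reverse, hw]⟩

/-- Identifying two vertices of the circular clique creates an odd closed walk of length
`2 * k + 1`, even when the marked edges are deleted. -/
theorem exists_unmarkedClique_walk_odd {k : ℕ} (hD : 2 ≤ D) (hP : 2 * D ≤ P) (hk : P = k * D)
    {x y : Fin (2 * P + D + 2)} (h : x ≠ y) :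
    ∃ w : (unmarkedClique P D).Walk x y, w.length = 2 * k + 1 := by
  have hx := x.2
  have hy := y.2
  have hxy : (x : ℕ) ≠ y := fun h' => h (Fin.ext h')
  obtain ⟨z, hz, hzy⟩ : ∃ z, (unmarkedClique P D).Adj x z ∧ ¬ (circularClique P D).Adj z y := by
    obtain ⟨z₁, h₁⟩ := exists_fin_val_eq_add x (r := P + 1) (by omega)
    obtain ⟨z₂, h₂⟩ := exists_fin_val_eq_add x (r := P + 1 + D) (by omega)
    by_cases hc : (circularClique P D).Adj z₁ y
    · refine ⟨z₂, ⟨by simp only [circularClique]; omega, by unfold IsMarkedEdge; omega⟩, ?_⟩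
      simp only [circularClique] at hc ⊢
      omega
    · exact ⟨z₁, ⟨by simp only [circularClique]; omega, by unfold IsMarkedEdge; omega⟩, hc⟩
  obtain ⟨w, hw⟩ := exists_unmarkedClique_walk_even hD hP hk hzy
  exact ⟨.cons hz w, by rw [Walk.length_cons, hw]⟩

/-- Every step of a walk advances by at least `P + 1` and at most `P + D + 1` around the circle; `m`
counts the full turns. -/
theorem circularClique_walk_displacement {x y : Fin (2 * P + D + 2)}
    (w : (circularClique P D).Walk x y) :
    ∃ S m : ℤ, w.length * (P + 1) ≤ S ∧ S ≤ w.length * (P + D + 1) ∧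
      (y : ℤ) = x + S - m * (2 * P + D + 2) := by
  induction w with
  | nil => exact ⟨0, 0, by simp⟩
  | @cons x z y h w ih =>
    obtain ⟨S, m, h1, h2, h3⟩ := ih
    rw [Walk.length_cons]
    push_cast
    simp only [circularClique] at h
    rcases h with h | h
    · refine ⟨S + (z - x), m, by linarith, by linarith, by linarith⟩
    · refine ⟨S + (z - x + (2 * P + D + 2)), m + 1, by linarith, by linarith, by linarith⟩

/-- A closed walk of odd length `2 * j + 1` with `j ≤ k` would have total displacement strictly
between `j` and `j + 1` full turns. -/
theorem circularClique_le_length {k : ℕ} (hk : P = k * D) (x : Fin (2 * P + D + 2))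
    (w : (circularClique P D).Walk x x) (hw : Odd w.length) : 2 * k + 3 ≤ w.length := by
  obtain ⟨S, m, h1, h2, h3⟩ := circularClique_walk_displacement w
  obtain ⟨j, hj⟩ := hw
  by_contra! hlt
  have hjk : (j : ℤ) ≤ k := by omega
  have hPz : (P : ℤ) = k * D := by exact_mod_cast hk
  have hjD : (j : ℤ) * D ≤ P := hPz ▸ mul_le_mul_of_nonneg_right hjk (by positivity)
  rw [hj] at h1 h2
  push_cast at h1 h2
  have hS : S = m * (2 * P + D + 2) := by linarith
  rw [hS] at h1 h2
  rcases le_or_gt m j with hm | hm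
  · have := mul_le_mul_of_nonneg_right hm (show (0 : ℤ) ≤ 2 * P + D + 2 by positivity)
    linarith
  · have := mul_le_mul_of_nonneg_right (show (j : ℤ) + 1 ≤ m from hm)
      (show (0 : ℤ) ≤ 2 * P + D + 2 by positivity)
    linarith

theorem natCard_circularClique_neighborSet (x : Fin (2 * P + D + 2)) :
    Nat.card ((circularClique P D).neighborSet x) = D + 1 := by
  have hx := x.2
  let f : Fin (D + 1) → (circularClique P D).neighborSet x := fun s =>
    ⟨⟨if (x : ℕ) + P + 1 + s < 2 * P + D + 2 then x + P + 1 + s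
      else x + P + 1 + s - (2 * P + D + 2), by have := s.2; split_ifs <;> omega⟩, by
      have := s.2
      simp only [mem_neighborSet, circularClique]
      split_ifs <;> omega⟩
  have hf : Function.Bijective f := by
    constructor
    · intro s s' h
      have h := congrArg (fun z => ((z.1 : Fin _) : ℕ)) h
      have := s.2
      have := s'.2
      simp only [f] at h
      ext
      split_ifs at h <;> omega
    · rintro ⟨z, hz⟩
      have hz2 := z.2
      simp only [mem_neighborSet, circularClique] at hz
      rcases hz with hz | hz
      · refine ⟨⟨z - x - P - 1, by omega⟩, Subtype.ext (Fin.ext ?_)⟩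
        simp only [f]
        split_ifs <;> omega
      · refine ⟨⟨z + (2 * P + D + 2) - x - P - 1, by omega⟩, Subtype.ext (Fin.ext ?_)⟩
        simp only [f]
        split_ifs <;> omega
  rw [← Nat.card_eq_of_bijective f hf, Nat.card_fin]

/-! ### Homomorphisms to the circular clique and its automorphisms -/

theorem unmarkedClique_hom_injective {k : ℕ} (hD : 2 ≤ D) (hP : 2 * D ≤ P) (hk : P = k * D)
    (h : unmarkedClique P D →g circularClique P D) : Function.Injective h := by
  intro x y hxy
  by_contra hne
  obtain ⟨w, hw⟩ := exists_unmarkedClique_walk_odd hD hP hk hne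
  have := circularClique_le_length hk _ ((w.map h).copy rfl hxy.symm)
    ⟨k, by rw [Walk.length_copy, Walk.length_map, hw]⟩
  rw [Walk.length_copy, Walk.length_map] at this
  omega

theorem adj_of_unmarkedClique_hom_adj {k : ℕ} (hD : 2 ≤ D) (hP : 2 * D ≤ P) (hk : P = k * D)
    (h : unmarkedClique P D →g circularClique P D) {x y : Fin (2 * P + D + 2)}
    (hxy : (circularClique P D).Adj (h x) (h y)) : (circularClique P D).Adj x y := by
  by_contra hne
  obtain ⟨w, hw⟩ := exists_unmarkedClique_walk_even hD hP hk hne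
  have := circularClique_le_length hk _ (.cons hxy.symm (w.map h))
    ⟨k, by rw [Walk.length_cons, Walk.length_map, hw]⟩
  rw [Walk.length_cons, Walk.length_map] at this
  omega

/-- Every homomorphism from the circular clique without its marked edges to the full circular clique
is the restriction of an automorphism. -/
theorem unmarkedClique_hom_eq_iso {k : ℕ} (hD : 2 ≤ D) (hP : 2 * D ≤ P) (hk : P = k * D)
    (h : unmarkedClique P D →g circularClique P D) :
    ∃ γ : circularClique P D ≃g circularClique P D, ∀ x, γ x = h x := by
  let e : Equiv.Perm (Fin (2 * P + D + 2)) := Equiv.ofBijective h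
    (Finite.injective_iff_bijective.1 (unmarkedClique_hom_injective hD hP hk h))
  have hrefl : ∀ x y, (circularClique P D).Adj (e x) (e y) → (circularClique P D).Adj x y :=
    fun x y hxy => adj_of_unmarkedClique_hom_adj hD hP hk h hxy
  -- On a finite set, an injection of the edge set into itself is onto.
  have hmaps : Set.MapsTo (e.symm.prodCongr e.symm : Equiv.Perm (_ × _))
      {p | (circularClique P D).Adj p.1 p.2} {p | (circularClique P D).Adj p.1 p.2} := by
    intro p hp
    apply hrefl
    simpa using hp
  have hinv := Equiv.Perm.perm_symm_mapsTo_of_mapsTo _ hmaps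
  refine ⟨⟨e, fun {x y} => ⟨hrefl x y, fun hxy => ?_⟩⟩, fun x => rfl⟩
  exact hinv (show (x, y) ∈ {p | (circularClique P D).Adj p.1 p.2} from hxy)

/-- The cyclic order is encoded in the graph: `y` is a cyclic neighbour of `x` exactly when one
vertex, and no other, is adjacent to `x` but not to `y`. -/
theorem existsUnique_circularClique_adj_not_adj_iff (hD : 2 ≤ D) (hP : 2 * D ≤ P)
    (x y : Fin (2 * P + D + 2)) :
    (∃! z, (circularClique P D).Adj x z ∧ ¬ (circularClique P D).Adj y z) ↔
      ((y : ℕ) = x + 1 ∨ (y : ℕ) + (2 * P + D + 2) = x + 1 ∨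
        (x : ℕ) = y + 1 ∨ (x : ℕ) + (2 * P + D + 2) = y + 1) := by
  have hx := x.2
  have hy := y.2
  obtain ⟨z₁, h₁⟩ := exists_fin_val_eq_add x (r := P + 1) (by omega)
  obtain ⟨z₂, h₂⟩ := exists_fin_val_eq_add x (r := P + 1 + 1) (by omega)
  obtain ⟨z₃, h₃⟩ := exists_fin_val_eq_add x (r := P + 1 + D) (by omega)
  obtain ⟨z₄, h₄⟩ := exists_fin_val_eq_add x (r := P + 1 + (D - 1)) (by omega)
  have hz₁ := z₁.2
  have hz₂ := z₂.2
  have hz₃ := z₃.2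
  have hz₄ := z₄.2
  constructor
  · rintro ⟨z, ⟨hxz, hyz⟩, huniq⟩
    by_contra hne
    have hxy : (x : ℕ) ≠ y := fun h' => hyz (Fin.ext h' ▸ hxz)
    by_cases hc : ∃ t ≤ D, (y : ℕ) = x + t ∨ (y : ℕ) + (2 * P + D + 2) = x + t
    -- If `y` is `x + t` with `2 ≤ t ≤ D`, the first two neighbours of `x` are not adjacent to `y`;
    -- for larger `t` the last two are not.
    · obtain ⟨t, htD, ht⟩ := hc
      have e₁ := huniq z₁ (by simp only [circularClique]; omega)
      have e₂ := huniq z₂ (by simp only [circularClique]; omega)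
      have : (z₁ : ℕ) = z₂ := by rw [e₁, e₂]
      omega
    · obtain ⟨t, htD, ht, ht'⟩ : ∃ t, D < t ∧ t < 2 * P + D + 2 ∧
          ((y : ℕ) = x + t ∨ (y : ℕ) + (2 * P + D + 2) = x + t) := by
        by_cases h' : (x : ℕ) ≤ y
        · refine ⟨y - x, ?_, by omega, by omega⟩
          by_contra h''
          exact hc ⟨y - x, by omega, by omega⟩
        · refine ⟨y + (2 * P + D + 2) - x, ?_, by omega, by omega⟩
          by_contra h''
          exact hc ⟨y + (2 * P + D + 2) - x, by omega, by omega⟩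
      have e₃ := huniq z₃ (by simp only [circularClique]; omega)
      have e₄ := huniq z₄ (by simp only [circularClique]; omega)
      have : (z₃ : ℕ) = z₄ := by rw [e₃, e₄]
      omega
  · intro h
    have key : ((y : ℕ) = x + 1 ∨ (y : ℕ) + (2 * P + D + 2) = x + 1) ∨
        ((x : ℕ) = y + 1 ∨ (x : ℕ) + (2 * P + D + 2) = y + 1) := by tauto
    rcases key with h | h
    · refine ⟨z₁, by simp only [circularClique]; omega, fun z hz => Fin.ext ?_⟩
      simp only [circularClique] at hz
      omega
    · refine ⟨z₃, by simp only [circularClique]; omega, fun z hz => Fin.ext ?_⟩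
      simp only [circularClique] at hz
      omega

/-- The automorphisms of the circular clique are rotations and reflections of the circle. -/
theorem circularClique_iso_eq (hD : 2 ≤ D) (hP : 2 * D ≤ P)
    (γ : circularClique P D ≃g circularClique P D) :
    ∃ t < 2 * P + D + 2,
      (∀ x, (γ x : ℕ) = t + x ∨ (γ x : ℕ) + (2 * P + D + 2) = t + x) ∨
      (∀ x, (γ x : ℕ) + x = t ∨ (γ x : ℕ) + x = t + (2 * P + D + 2)) := by
  have hnear : ∀ m (hm : m + 1 < 2 * P + D + 2),
      ((γ ⟨m + 1, hm⟩ : ℕ) = γ ⟨m, by omega⟩ + 1 ∨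
        (γ ⟨m + 1, hm⟩ : ℕ) + (2 * P + D + 2) = γ ⟨m, by omega⟩ + 1 ∨
        (γ ⟨m, by omega⟩ : ℕ) = γ ⟨m + 1, hm⟩ + 1 ∨
        (γ ⟨m, by omega⟩ : ℕ) + (2 * P + D + 2) = γ ⟨m + 1, hm⟩ + 1) := by
    intro m hm
    rw [← existsUnique_circularClique_adj_not_adj_iff hD hP]
    obtain ⟨z, hz, hu⟩ := (existsUnique_circularClique_adj_not_adj_iff hD hP
      ⟨m, by omega⟩ ⟨m + 1, hm⟩).2 (Or.inl rfl)
    refine ⟨γ z, by simpa only [γ.map_adj_iff] using hz, fun u hu' => ?_⟩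
    rw [← γ.symm_apply_eq]
    apply hu
    rwa [← γ.map_adj_iff, γ.apply_symm_apply, ← γ.map_adj_iff (v := ⟨m + 1, hm⟩),
      γ.apply_symm_apply]
  have hne : ∀ m (hm : m + 1 + 1 < 2 * P + D + 2), (γ ⟨m + 1 + 1, hm⟩ : ℕ) ≠ γ ⟨m, by omega⟩ := by
    intro m hm h
    have := γ.injective (Fin.ext h)
    simp only [Fin.mk.injEq] at this
    omega
  have hlt : ∀ x, (γ x : ℕ) < 2 * P + D + 2 := fun x => (γ x).2
  obtain ⟨t, ht⟩ : ∃ t, (γ ⟨0, by omega⟩ : ℕ) = t := ⟨_, rfl⟩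
  have h01 := hnear 0 (by omega)
  have hl0 := hlt ⟨0, by omega⟩
  have hl1 := hlt ⟨1, by omega⟩
  simp only [zero_add, ht] at h01 hl0
  refine ⟨t, hl0, ?_⟩
  have hcases : ((γ ⟨1, by omega⟩ : ℕ) = t + 1 ∨ (γ ⟨1, by omega⟩ : ℕ) + (2 * P + D + 2) = t + 1) ∨
      ((γ ⟨1, by omega⟩ : ℕ) + 1 = t ∨ (γ ⟨1, by omega⟩ : ℕ) + 1 = t + (2 * P + D + 2)) := by
    omega
  refine hcases.imp (fun h1 => ?_) (fun h1 => ?_)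
  · have key : ∀ m (hm : m + 1 < 2 * P + D + 2),
        ((γ ⟨m, by omega⟩ : ℕ) = t + m ∨ (γ ⟨m, by omega⟩ : ℕ) + (2 * P + D + 2) = t + m) ∧
        ((γ ⟨m + 1, hm⟩ : ℕ) = t + (m + 1) ∨
          (γ ⟨m + 1, hm⟩ : ℕ) + (2 * P + D + 2) = t + (m + 1)) := by
      intro m
      induction m with
      | zero => exact fun _ => ⟨Or.inl ht, h1⟩
      | succ m ih =>
        intro hm
        have ih := ih (by omega)
        have a := hnear (m + 1) hm
        have b := hne m hm
        have c := hlt ⟨m + 1 + 1, hm⟩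
        have e := hlt ⟨m, by omega⟩
        exact ⟨ih.2, by omega⟩
    rintro ⟨x, hx⟩
    by_cases hx' : x + 1 < 2 * P + D + 2
    · exact (key x hx').1
    · obtain ⟨m, rfl⟩ : ∃ m, x = m + 1 := ⟨x - 1, by omega⟩
      exact (key m hx).2
  · have key : ∀ m (hm : m + 1 < 2 * P + D + 2),
        ((γ ⟨m, by omega⟩ : ℕ) + m = t ∨ (γ ⟨m, by omega⟩ : ℕ) + m = t + (2 * P + D + 2)) ∧
        ((γ ⟨m + 1, hm⟩ : ℕ) + (m + 1) = t ∨
          (γ ⟨m + 1, hm⟩ : ℕ) + (m + 1) = t + (2 * P + D + 2)) := by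
      intro m
      induction m with
      | zero => exact fun _ => ⟨Or.inl ht, h1⟩
      | succ m ih =>
        intro hm
        have ih := ih (by omega)
        have a := hnear (m + 1) hm
        have b := hne m hm
        have c := hlt ⟨m + 1 + 1, hm⟩
        have e := hlt ⟨m, by omega⟩
        exact ⟨ih.2, by omega⟩
    rintro ⟨x, hx⟩
    by_cases hx' : x + 1 < 2 * P + D + 2
    · exact (key x hx').1
    · obtain ⟨m, rfl⟩ : ∃ m, x = m + 1 := ⟨x - 1, by omega⟩
      exact (key m hx).2

/-! ### Covers with voltages on the marked edges -/

/-- Arithmetic core of the rigidity of the marked edges. Let `M` consist of the edges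
`{s, s + P + 2}` and `{s + D, s + D + P + 2}`, the marked edges rotated by `s`. Suppose that each
of the two 4-cycles `0, P + 2, 1, P + 3` and `0, P + 2, -1, P + 1` through the first marked edge
contains an edge of `M`, and likewise for the second marked edge. Then both marked edges belong
to `M`. -/
theorem marked_of_forall_fourCycle_meets (hD : 2 ≤ D) (hP : 2 * D ≤ P) {s : ℕ}
    (hs : s < 2 * P + D + 2) (M : ℕ → ℕ → Prop)
    (hM : ∀ y z, y < 2 * P + D + 2 → z < 2 * P + D + 2 → (M y z ↔
      ((y = s ∧ (z = s + (P + 2) ∨ z + (2 * P + D + 2) = s + (P + 2))) ∨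
      ((y = s + (P + 2) ∨ y + (2 * P + D + 2) = s + (P + 2)) ∧ z = s) ∨
      ((y = s + D ∨ y + (2 * P + D + 2) = s + D) ∧
        (z = s + D + (P + 2) ∨ z + (2 * P + D + 2) = s + D + (P + 2))) ∨
      ((y = s + D + (P + 2) ∨ y + (2 * P + D + 2) = s + D + (P + 2)) ∧
        (z = s + D ∨ z + (2 * P + D + 2) = s + D)))))
    (h₁ : M 0 (P + 2) ∨ M (P + 2) 1 ∨ M 1 (P + 3) ∨ M (P + 3) 0)
    (h₂ : M 0 (P + 2) ∨ M (P + 2) (2 * P + D + 1) ∨ M (2 * P + D + 1) (P + 1) ∨ M (P + 1) 0)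
    (h₃ : M D (D + P + 2) ∨ M (D + P + 2) (D + 1) ∨ M (D + 1) (D + P + 3) ∨ M (D + P + 3) D)
    (h₄ : M D (D + P + 2) ∨ M (D + P + 2) (D - 1) ∨ M (D - 1) (D + P + 1) ∨ M (D + P + 1) D) :
    M 0 (P + 2) ∧ M D (D + P + 2) := by
  -- The positions `s` at which each edge of the four 4-cycles belongs to `M`. Differences of
  -- `P + 3` matter only for `D = 3`, where `-(P + 2)` is `P + 3` modulo `2 * P + D + 2`.
  have a1 : ¬ M (P + 2) 1 := fun h => by
    have := (hM _ _ (by omega) (by omega)).1 h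
    omega
  have a2 : M 1 (P + 3) →
      s = 1 ∨ (D = 2 ∧ s = P + 3) ∨ s + D = 2 * P + D + 3 ∨ (D = 2 ∧ s + D = P + 3) := fun h => by
    have := (hM _ _ (by omega) (by omega)).1 h
    omega
  have a3 : M (P + 3) 0 →
      D = 3 ∧ (s = P + 3 ∨ s + D = P + 3) := fun h => by
    have := (hM _ _ (by omega) (by omega)).1 h
    omega
  have b1 : M (P + 2) (2 * P + D + 1) →
      D = 3 ∧ (s = P + 2 ∨ s + D = P + 2) := fun h => by
    have := (hM _ _ (by omega) (by omega)).1 h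
    omega
  have b2 : M (2 * P + D + 1) (P + 1) →
      s = 2 * P + D + 1 ∨ s + D = 2 * P + D + 1 ∨ D = 2 ∧ (s = P + 1 ∨ s + D = P + 1) := fun h => by
    have := (hM _ _ (by omega) (by omega)).1 h
    omega
  have b3 : ¬ M (P + 1) 0 := fun h => by
    have := (hM _ _ (by omega) (by omega)).1 h
    omega
  have c1 : ¬ M (D + P + 2) (D + 1) := fun h => by
    have := (hM _ _ (by omega) (by omega)).1 h
    omega
  have c2 : M (D + 1) (D + P + 3) →
      s = 1 ∨ s = D + 1 ∨ D = 2 ∧ (s = D + P + 3 ∨ s = P + 3) := fun h => by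
    have := (hM _ _ (by omega) (by omega)).1 h
    omega
  have c3 : M (D + P + 3) D →
      D = 3 ∧ (s = D + P + 3 ∨ s = P + 3) := fun h => by
    have := (hM _ _ (by omega) (by omega)).1 h
    omega
  have d1 : M (D + P + 2) (D - 1) →
      D = 3 ∧ (s = D + P + 2 ∨ s = P + 2) := fun h => by
    have := (hM _ _ (by omega) (by omega)).1 h
    omega
  have d2 : M (D - 1) (D + P + 1) →
      s = D - 1 ∨ s = 2 * P + D + 1 ∨ D = 2 ∧ (s = D + P + 1 ∨ s = P + 1) := fun h => by
    have := (hM _ _ (by omega) (by omega)).1 h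
    omega
  have d3 : ¬ M (D + P + 1) D := fun h => by
    have := (hM _ _ (by omega) (by omega)).1 h
    omega
  have e1 : M 0 (P + 2) →
      s = 0 ∨ s + D = 2 * P + D + 2 ∨ D = 2 ∧ (s = P + 2 ∨ s = P) := fun h => by
    have := (hM _ _ (by omega) (by omega)).1 h
    omega
  have e2 : M D (D + P + 2) →
      s = 0 ∨ s = D ∨ D = 2 ∧ (s = P + 2 ∨ s = P + 4) := fun h => by
    have := (hM _ _ (by omega) (by omega)).1 h
    omega
  have f1 := hM 0 (P + 2) (by omega) (by omega)
  have f2 := hM D (D + P + 2) (by omega) (by omega)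
  constructor
  · by_contra hn
    have k₁ := (h₁.resolve_left hn).resolve_left a1 |>.imp a2 a3
    have k₂ := (h₂.resolve_left hn).imp b1 (fun h => b2 (h.resolve_right b3))
    by_cases h : M D (D + P + 2)
    · have := e2 h
      rw [f1] at hn
      omega
    · have k₃ := (h₃.resolve_left h).resolve_left c1 |>.imp c2 c3
      have k₄ := (h₄.resolve_left h).imp d1 (fun h => d2 (h.resolve_right d3))
      omega
  · by_contra hn
    have k₃ := (h₃.resolve_left hn).resolve_left c1 |>.imp c2 c3
    have k₄ := (h₄.resolve_left hn).imp d1 (fun h => d2 (h.resolve_right d3))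
    by_cases h : M 0 (P + 2)
    · have := e1 h
      rw [f2] at hn
      omega
    · have k₁ := (h₁.resolve_left h).resolve_left a1 |>.imp a2 a3
      have k₂ := (h₂.resolve_left h).imp b1 (fun h => b2 (h.resolve_right b3))
      omega

/-- The image of the marked edges under an automorphism of the circular clique. -/
def IsMarkedImage (γ : circularClique P D ≃g circularClique P D) (y z : ℕ) : Prop :=
  ∃ u v : Fin (2 * P + D + 2), IsMarkedEdge P D u v ∧ (γ u : ℕ) = y ∧ (γ v : ℕ) = z

/-- The image of the marked edges under an automorphism is also their image under a rotation, since
some reflection swaps them. -/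
theorem exists_isMarkedImage_iff (hD : 2 ≤ D) (hP : 2 * D ≤ P)
    (γ : circularClique P D ≃g circularClique P D) :
    ∃ s < 2 * P + D + 2, ∀ y z, y < 2 * P + D + 2 → z < 2 * P + D + 2 → (IsMarkedImage γ y z ↔
      ((y = s ∧ (z = s + (P + 2) ∨ z + (2 * P + D + 2) = s + (P + 2))) ∨
      ((y = s + (P + 2) ∨ y + (2 * P + D + 2) = s + (P + 2)) ∧ z = s) ∨
      ((y = s + D ∨ y + (2 * P + D + 2) = s + D) ∧
        (z = s + D + (P + 2) ∨ z + (2 * P + D + 2) = s + D + (P + 2))) ∨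
      ((y = s + D + (P + 2) ∨ y + (2 * P + D + 2) = s + D + (P + 2)) ∧
        (z = s + D ∨ z + (2 * P + D + 2) = s + D)))) := by
  have hM : ∀ y z, IsMarkedImage γ y z ↔
      (γ ⟨0, by omega⟩ : ℕ) = y ∧ (γ ⟨P + 2, by omega⟩ : ℕ) = z ∨
      (γ ⟨P + 2, by omega⟩ : ℕ) = y ∧ (γ ⟨0, by omega⟩ : ℕ) = z ∨
      (γ ⟨D, by omega⟩ : ℕ) = y ∧ (γ ⟨D + P + 2, by omega⟩ : ℕ) = z ∨
      (γ ⟨D + P + 2, by omega⟩ : ℕ) = y ∧ (γ ⟨D, by omega⟩ : ℕ) = z := by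
    intro y z
    constructor
    · rintro ⟨⟨u, hu⟩, ⟨v, hv⟩, h, rfl, rfl⟩
      rcases h with h | h | h | h <;> obtain ⟨h1, h2⟩ := h <;> simp only at h1 h2 <;>
        subst h1 h2 <;> simp
    · rintro (h | h | h | h)
      · exact ⟨_, _, Or.inl ⟨rfl, rfl⟩, h⟩
      · exact ⟨_, _, Or.inr (Or.inl ⟨rfl, rfl⟩), h⟩
      · exact ⟨_, _, Or.inr (Or.inr (Or.inl ⟨rfl, rfl⟩)), h⟩
      · exact ⟨_, _, Or.inr (Or.inr (Or.inr ⟨rfl, rfl⟩)), h⟩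
  have b₁ := (γ ⟨0, by omega⟩).2
  have b₂ := (γ ⟨P + 2, by omega⟩).2
  have b₃ := (γ ⟨D, by omega⟩).2
  have b₄ := (γ ⟨D + P + 2, by omega⟩).2
  obtain ⟨t, ht, h⟩ := circularClique_iso_eq hD hP γ
  generalize hg₁ : (γ ⟨0, by omega⟩ : ℕ) = g₁ at hM b₁
  generalize hg₂ : (γ ⟨P + 2, by omega⟩ : ℕ) = g₂ at hM b₂
  generalize hg₃ : (γ ⟨D, by omega⟩ : ℕ) = g₃ at hM b₃
  generalize hg₄ : (γ ⟨D + P + 2, by omega⟩ : ℕ) = g₄ at hM b₄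
  rcases h with h | h
  · have c₁ := h ⟨0, by omega⟩
    have c₂ := h ⟨P + 2, by omega⟩
    have c₃ := h ⟨D, by omega⟩
    have c₄ := h ⟨D + P + 2, by omega⟩
    simp only [hg₁, hg₂, hg₃, hg₄] at c₁ c₂ c₃ c₄
    have e₁ : ∀ y, g₁ = y ↔ y = t := by omega
    have e₂ : ∀ y < 2 * P + D + 2, g₂ = y ↔
        (y = t + (P + 2) ∨ y + (2 * P + D + 2) = t + (P + 2)) := by omega
    have e₃ : ∀ y < 2 * P + D + 2, g₃ = y ↔
        (y = t + D ∨ y + (2 * P + D + 2) = t + D) := by omega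
    have e₄ : ∀ y < 2 * P + D + 2, g₄ = y ↔
        (y = t + D + (P + 2) ∨ y + (2 * P + D + 2) = t + D + (P + 2)) := by omega
    refine ⟨t, ht, fun y z hy hz => ?_⟩
    rw [hM, e₁, e₁, e₂ y hy, e₂ z hz, e₃ y hy, e₃ z hz, e₄ y hy, e₄ z hz]
  · have c₁ := h ⟨0, by omega⟩
    have c₂ := h ⟨P + 2, by omega⟩
    have c₃ := h ⟨D, by omega⟩
    have c₄ := h ⟨D + P + 2, by omega⟩
    simp only [hg₁, hg₂, hg₃, hg₄] at c₁ c₂ c₃ c₄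
    have e₄ : ∀ y, g₄ = y ↔ y = g₄ := fun y => eq_comm
    have e₃ : ∀ y < 2 * P + D + 2, g₃ = y ↔
        (y = g₄ + (P + 2) ∨ y + (2 * P + D + 2) = g₄ + (P + 2)) := by omega
    have e₂ : ∀ y < 2 * P + D + 2, g₂ = y ↔
        (y = g₄ + D ∨ y + (2 * P + D + 2) = g₄ + D) := by omega
    have e₁ : ∀ y < 2 * P + D + 2, g₁ = y ↔
        (y = g₄ + D + (P + 2) ∨ y + (2 * P + D + 2) = g₄ + D + (P + 2)) := by omega
    refine ⟨g₄, b₄, fun y z hy hz => ?_⟩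
    rw [hM, e₄, e₄, e₂ y hy, e₂ z hz, e₃ y hy, e₃ z hz, e₁ y hy, e₁ z hz]
    constructor
    · rintro (h | h | h | h)
      exacts [.inr (.inr (.inr h)), .inr (.inr (.inl h)), .inr (.inl h), .inl h]
    · rintro (h | h | h | h)
      exacts [.inr (.inr (.inr h)), .inr (.inr (.inl h)), .inr (.inl h), .inl h]

/-- The voltage assignment that puts `σ` on the dart from `0` to `P + 2`, `τ` on the dart from `D`
to `D + P + 2`, and the identity on the unmarked edges. -/
def markedVoltage {I : Type*} (P D : ℕ) (σ τ : Equiv.Perm I) (x y : ℕ) : Equiv.Perm I :=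
  if x = 0 ∧ y = P + 2 then σ else if x = P + 2 ∧ y = 0 then σ⁻¹
  else if x = D ∧ y = D + P + 2 then τ else if x = D + P + 2 ∧ y = D then τ⁻¹ else 1

theorem markedVoltage_swap {I : Type*} (P D : ℕ) (σ τ : Equiv.Perm I) (x y : ℕ) :
    markedVoltage P D σ τ y x = (markedVoltage P D σ τ x y)⁻¹ := by
  unfold markedVoltage
  split_ifs <;> first | omega | simp

theorem markedVoltage_eq_one {I : Type*} {σ τ : Equiv.Perm I} {x y : ℕ}
    (h : ¬ IsMarkedEdge P D x y) : markedVoltage P D σ τ x y = 1 := by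
  unfold IsMarkedEdge at h
  unfold markedVoltage
  split_ifs <;> first | omega | rfl

theorem markedVoltage_first {I : Type*} (P D : ℕ) (σ τ : Equiv.Perm I) :
    markedVoltage P D σ τ 0 (P + 2) = σ := by
  simp [markedVoltage]

theorem markedVoltage_second {I : Type*} (P : ℕ) {D : ℕ} (hD : 0 < D) (σ τ : Equiv.Perm I) :
    markedVoltage P D σ τ D (D + P + 2) = τ := by
  unfold markedVoltage
  rw [if_neg (by omega), if_neg (by omega), if_pos ⟨rfl, rfl⟩]

/-- The cover of the circular clique with voltages `σ` and `τ` on the marked edges: disjoint copies,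
indexed by `I`, of the clique without its marked edges, joined along the marked edges according to
`σ` and `τ`. -/
def markedLift {I : Type*} (P D : ℕ) (σ τ : Equiv.Perm I) :
    SimpleGraph (I × Fin (2 * P + D + 2)) :=
  (circularClique P D).voltageLift (fun x y => markedVoltage P D σ τ x y)
    fun x y => markedVoltage_swap P D σ τ x y

/-- Let `ψ` be a lift to the cover of the circular clique with the `γ`-images of the marked edges
removed. A 4-cycle through one marked edge on which `ψ` is defined would give a fixed point of the
voltage of that edge; so if the voltages have no fixed points, `γ` preserves the marked edges. -/
theorem isMarkedImage_of_section (hD : 2 ≤ D) (hP : 2 * D ≤ P) {I : Type*} {σ τ : Equiv.Perm I}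
    (hσ : ∀ i, σ i ≠ i) (hτ : ∀ i, τ i ≠ i) (γ : circularClique P D ≃g circularClique P D)
    (ψ : Fin (2 * P + D + 2) → I)
    (hψ : ∀ y z, (circularClique P D).Adj y z → ¬ IsMarkedImage γ y z →
      ψ z = markedVoltage P D σ τ y z (ψ y)) :
    IsMarkedImage γ 0 (P + 2) ∧ IsMarkedImage γ D (D + P + 2) := by
  have square : ∀ (a b c e : ℕ) (ha : a < 2 * P + D + 2) (hb : b < 2 * P + D + 2)
      (hc : c < 2 * P + D + 2) (he : e < 2 * P + D + 2)
      (_ : (circularClique P D).Adj ⟨a, ha⟩ ⟨b, hb⟩) (_ : (circularClique P D).Adj ⟨b, hb⟩ ⟨c, hc⟩)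
      (_ : (circularClique P D).Adj ⟨c, hc⟩ ⟨e, he⟩) (_ : (circularClique P D).Adj ⟨e, he⟩ ⟨a, ha⟩)
      (_ : ∀ i, markedVoltage P D σ τ a b i ≠ i) (_ : ¬ IsMarkedEdge P D b c)
      (_ : ¬ IsMarkedEdge P D c e) (_ : ¬ IsMarkedEdge P D e a),
      IsMarkedImage γ a b ∨ IsMarkedImage γ b c ∨ IsMarkedImage γ c e ∨ IsMarkedImage γ e a := by
    intro a b c e ha hb hc he hab hbc hce hea hne nbc nce nea
    by_contra! hn
    have h₁ := hψ _ _ hab hn.1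
    have h₂ := hψ _ _ hbc hn.2.1
    have h₃ := hψ _ _ hce hn.2.2.1
    have h₄ := hψ _ _ hea hn.2.2.2
    simp only [markedVoltage_eq_one nbc, markedVoltage_eq_one nce, markedVoltage_eq_one nea,
      Equiv.Perm.one_apply] at h₂ h₃ h₄
    apply hne (ψ ⟨a, ha⟩)
    rw [← h₁, ← h₂, ← h₃, ← h₄]
  obtain ⟨s, hs, hM⟩ := exists_isMarkedImage_iff hD hP γ
  refine marked_of_forall_fourCycle_meets hD hP hs (IsMarkedImage γ) hM
    (square _ _ _ _ ?_ ?_ ?_ ?_ ?_ ?_ ?_ ?_ ?_ ?_ ?_ ?_)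
    (square _ _ _ _ ?_ ?_ ?_ ?_ ?_ ?_ ?_ ?_ ?_ ?_ ?_ ?_)
    (square _ _ _ _ ?_ ?_ ?_ ?_ ?_ ?_ ?_ ?_ ?_ ?_ ?_ ?_)
    (square _ _ _ _ ?_ ?_ ?_ ?_ ?_ ?_ ?_ ?_ ?_ ?_ ?_ ?_)
  all_goals first
    | omega
    | (simp only [circularClique]; omega)
    | (unfold IsMarkedEdge; omega)
    | (rw [markedVoltage_first]; exact hσ)
    | (rw [markedVoltage_second P (by omega)]; exact hτ)

/-! ### Homomorphisms between covers -/

/-- A homomorphism between covers maps each copy of the unmarked clique onto a single copy, by an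
automorphism that preserves the marked edges. -/
theorem markedLift_hom_block {k : ℕ} (hD : 2 ≤ D) (hP : 2 * D ≤ P) (hk : P = k * D) {I I' : Type*}
    {σ τ : Equiv.Perm I} {σ' τ' : Equiv.Perm I'} (hσ : ∀ i, σ' i ≠ i) (hτ : ∀ i, τ' i ≠ i)
    (f : markedLift P D σ τ →g markedLift P D σ' τ') (i : I) :
    ∃ (γ : circularClique P D ≃g circularClique P D) (j : I'),
      (∀ x, f (i, x) = (j, γ x)) ∧ IsMarkedImage γ 0 (P + 2) ∧ IsMarkedImage γ D (D + P + 2) := by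
  have hf : ∀ x y, (unmarkedClique P D).Adj x y →
      (markedLift P D σ' τ').Adj (f (i, x)) (f (i, y)) := fun x y h =>
    f.map_rel ⟨h.1, by simp [markedVoltage_eq_one h.2]⟩
  obtain ⟨γ, hγ⟩ := unmarkedClique_hom_eq_iso hD hP hk
    ⟨fun x => (f (i, x)).2, fun {x y} h => (hf x y h).1⟩
  have hγ : ∀ x, γ x = (f (i, x)).2 := hγ
  have hnot : ∀ x y, (circularClique P D).Adj x y → ¬ IsMarkedImage γ (γ x) (γ y) →
      (f (i, y)).1 = markedVoltage P D σ' τ' (γ x) (γ y) (f (i, x)).1 := by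
    intro x y hxy hn
    have := (hf x y ⟨hxy, fun h => hn ⟨x, y, h, rfl, rfl⟩⟩).2
    simpa only [← hγ] using this
  have hmark := isMarkedImage_of_section hD hP hσ hτ γ (fun y => (f (i, γ.symm y)).1)
    (fun y z hyz hn => by
      have := hnot (γ.symm y) (γ.symm z) (γ.symm.map_adj_iff.2 hyz) (by simpa using hn)
      simpa using this)
  have hsub : ∀ x y : Fin (2 * P + D + 2), IsMarkedEdge P D (γ x) (γ y) → IsMarkedEdge P D x y := by
    have key : ∀ (a b : ℕ) (x y : Fin (2 * P + D + 2)), IsMarkedImage γ a b → (γ x : ℕ) = a →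
        (γ y : ℕ) = b → IsMarkedEdge P D x y := by
      rintro a b x y ⟨u, v, h, rfl, rfl⟩ h1 h2
      rwa [γ.injective (Fin.ext h1), γ.injective (Fin.ext h2)]
    rintro x y (h | h | h | h)
    · exact key _ _ x y hmark.1 h.1 h.2
    · exact isMarkedEdge_comm.1 (key _ _ y x hmark.1 h.2 h.1)
    · exact key _ _ x y hmark.2 h.1 h.2
    · exact isMarkedEdge_comm.1 (key _ _ y x hmark.2 h.2 h.1)
  have hstep : ∀ x y, (unmarkedClique P D).Adj x y → (f (i, y)).1 = (f (i, x)).1 := by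
    intro x y h
    have := (hf x y h).2
    simpa only [← hγ, markedVoltage_eq_one (fun h' => h.2 (hsub x y h')), Equiv.Perm.one_apply]
      using this
  have hwalk : ∀ x y (_ : (unmarkedClique P D).Walk x y), (f (i, y)).1 = (f (i, x)).1 := by
    intro x y w
    induction w with
    | nil => rfl
    | cons h _ ih => exact ih.trans (hstep _ _ h)
  refine ⟨γ, (f (i, ⟨0, by omega⟩)).1, fun x => Prod.ext ?_ (hγ x).symm, hmark⟩
  by_cases hx : x = ⟨0, by omega⟩
  · rw [hx]
  · obtain ⟨w, -⟩ := exists_unmarkedClique_walk_odd hD hP hk (Ne.symm hx)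
    exact hwalk _ _ w

theorem isMarkedEdge_of_isMarkedImage {γ : circularClique P D ≃g circularClique P D}
    (hD : 2 ≤ D) (hP : 2 * D ≤ P)
    (h₁ : IsMarkedImage γ 0 (P + 2)) (h₂ : IsMarkedImage γ D (D + P + 2)) :
    IsMarkedEdge P D (γ ⟨0, by omega⟩) (γ ⟨P + 2, by omega⟩) ∧
      IsMarkedEdge P D (γ ⟨D, by omega⟩) (γ ⟨D + P + 2, by omega⟩) := by
  obtain ⟨⟨u, hu⟩, ⟨v, hv⟩, h, e₁, e₂⟩ := h₁
  obtain ⟨⟨u', hu'⟩, ⟨v', hv'⟩, h', e₁', e₂'⟩ := h₂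
  unfold IsMarkedEdge at *
  rcases h with h | h | h | h <;> obtain ⟨h1, h2⟩ := h <;> simp only at h1 h2 <;> subst h1 h2 <;>
  rcases h' with h | h | h | h <;> obtain ⟨h1, h2⟩ := h <;> simp only at h1 h2 <;> subst h1 h2 <;>
  omega

/-- Two automorphisms that preserve the marked edges and are compatible along the first marked edge
coincide: the four marked endpoints span no edges besides the two marked ones, so the automorphisms
agree at `P + 2`, and a rotation and a reflection preserving the marked edges never agree there. -/
theorem marked_iso_eq {γ γ' : circularClique P D ≃g circularClique P D} (hD : 2 ≤ D)
    (hP : 2 * D ≤ P)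
    (h : IsMarkedEdge P D (γ ⟨0, by omega⟩) (γ ⟨P + 2, by omega⟩) ∧
      IsMarkedEdge P D (γ ⟨D, by omega⟩) (γ ⟨D + P + 2, by omega⟩))
    (h' : IsMarkedEdge P D (γ' ⟨0, by omega⟩) (γ' ⟨P + 2, by omega⟩) ∧
      IsMarkedEdge P D (γ' ⟨D, by omega⟩) (γ' ⟨D + P + 2, by omega⟩))
    (hadj : (circularClique P D).Adj (γ ⟨0, by omega⟩) (γ' ⟨P + 2, by omega⟩)) : γ' = γ := by
  have heq : (γ' ⟨P + 2, by omega⟩ : ℕ) = γ ⟨P + 2, by omega⟩ := by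
    have h1 := h.1
    have h2 := h'.1
    unfold IsMarkedEdge at h1 h2
    simp only [circularClique] at hadj
    omega
  have bd : ∀ x, (γ x : ℕ) < 2 * P + D + 2 := fun x => (γ x).2
  have bd' : ∀ x, (γ' x : ℕ) < 2 * P + D + 2 := fun x => (γ' x).2
  have mixed : ∀ (δ δ' : circularClique P D ≃g circularClique P D) (t t' : ℕ)
      (_ : IsMarkedEdge P D (δ ⟨D, by omega⟩) (δ ⟨D + P + 2, by omega⟩))
      (_ : IsMarkedEdge P D (δ' ⟨D, by omega⟩) (δ' ⟨D + P + 2, by omega⟩))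
      (_ : IsMarkedEdge P D (δ ⟨0, by omega⟩) (δ ⟨P + 2, by omega⟩))
      (_ : (δ' ⟨P + 2, by omega⟩ : ℕ) = δ ⟨P + 2, by omega⟩)
      (_ : ∀ x, (δ x : ℕ) = t + x ∨ (δ x : ℕ) + (2 * P + D + 2) = t + x)
      (_ : ∀ x, (δ' x : ℕ) + x = t' ∨ (δ' x : ℕ) + x = t' + (2 * P + D + 2)), False := by
    intro δ δ' t t' m m' m₀ he hd hd'
    have a := hd ⟨P + 2, by omega⟩
    have b := hd ⟨D + P + 2, by omega⟩
    have a' := hd' ⟨P + 2, by omega⟩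
    have b' := hd' ⟨D + P + 2, by omega⟩
    simp only [he] at a a' b b'
    have p₀ : (δ ⟨P + 2, by omega⟩ : ℕ) = 0 ∨ (δ ⟨P + 2, by omega⟩ : ℕ) = P + 2 ∨
        (δ ⟨P + 2, by omega⟩ : ℕ) = D ∨ (δ ⟨P + 2, by omega⟩ : ℕ) = D + P + 2 := by
      unfold IsMarkedEdge at m₀; omega
    have p₁ : (δ ⟨D + P + 2, by omega⟩ : ℕ) = 0 ∨ (δ ⟨D + P + 2, by omega⟩ : ℕ) = P + 2 ∨
        (δ ⟨D + P + 2, by omega⟩ : ℕ) = D ∨ (δ ⟨D + P + 2, by omega⟩ : ℕ) = D + P + 2 := by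
      unfold IsMarkedEdge at m; omega
    have p₂ : (δ' ⟨D + P + 2, by omega⟩ : ℕ) = 0 ∨ (δ' ⟨D + P + 2, by omega⟩ : ℕ) = P + 2 ∨
        (δ' ⟨D + P + 2, by omega⟩ : ℕ) = D ∨ (δ' ⟨D + P + 2, by omega⟩ : ℕ) = D + P + 2 := by
      unfold IsMarkedEdge at m'; omega
    omega
  obtain ⟨t, ht, hγ⟩ := circularClique_iso_eq hD hP γ
  obtain ⟨t', ht', hγ'⟩ := circularClique_iso_eq hD hP γ'
  rcases hγ with hγ | hγ <;> rcases hγ' with hγ' | hγ'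
  · ext x
    have := hγ ⟨P + 2, by omega⟩
    have := hγ' ⟨P + 2, by omega⟩
    have := hγ x
    have := hγ' x
    have := bd x
    have := bd' x
    simp only at *
    omega
  · exact (mixed γ γ' t t' h.2 h'.2 h.1 heq hγ hγ').elim
  · exact (mixed γ' γ t' t h'.2 h.2 h'.1 heq.symm hγ' hγ).elim
  · ext x
    have := hγ ⟨P + 2, by omega⟩
    have := hγ' ⟨P + 2, by omega⟩
    have := hγ x
    have := hγ' x
    have := bd x
    have := bd' x
    simp only at *
    omega

/-- A homomorphism between covers with fixed-point-free voltages, the first of which is transitive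
on the source, is a product of a map of index sets and an automorphism of the base, and the map of
index sets intertwines the voltages up to the action of the automorphism on the marked edges. -/
theorem markedLift_hom_eq {k : ℕ} (hD : 2 ≤ D) (hP : 2 * D ≤ P) (hk : P = k * D) {I I' : Type*}
    {σ τ : Equiv.Perm I} {σ' τ' : Equiv.Perm I'} (hσ : ∀ i, σ' i ≠ i) (hτ : ∀ i, τ' i ≠ i)
    (i₀ : I) (htrans : ∀ i, ∃ m : ℕ, σ^[m] i₀ = i)
    (f : markedLift P D σ τ →g markedLift P D σ' τ') :
    ∃ (γ : circularClique P D ≃g circularClique P D) (φ : I → I'),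
      (∀ i x, f (i, x) = (φ i, γ x)) ∧
      IsMarkedEdge P D (γ ⟨0, by omega⟩) (γ ⟨P + 2, by omega⟩) ∧
      IsMarkedEdge P D (γ ⟨D, by omega⟩) (γ ⟨D + P + 2, by omega⟩) ∧
      (∀ i, φ (σ i) =
        markedVoltage P D σ' τ' (γ ⟨0, by omega⟩) (γ ⟨P + 2, by omega⟩) (φ i)) ∧
      (∀ i, φ (τ i) =
        markedVoltage P D σ' τ' (γ ⟨D, by omega⟩) (γ ⟨D + P + 2, by omega⟩) (φ i)) := by
  choose γ φ hf hm₁ hm₂ using markedLift_hom_block hD hP hk hσ hτ f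
  have hm := fun i => isMarkedEdge_of_isMarkedImage hD hP (hm₁ i) (hm₂ i)
  have e₁ : ∀ i, (markedLift P D σ' τ').Adj (φ i, γ i ⟨0, by omega⟩)
      (φ (σ i), γ (σ i) ⟨P + 2, by omega⟩) := fun i => by
    rw [← hf, ← hf]
    exact f.map_rel ⟨by simp only [circularClique]; omega, by simp only [markedVoltage_first]⟩
  have e₂ : ∀ i, (markedLift P D σ' τ').Adj (φ i, γ i ⟨D, by omega⟩)
      (φ (τ i), γ (τ i) ⟨D + P + 2, by omega⟩) := fun i => by
    rw [← hf, ← hf]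
    exact f.map_rel ⟨by simp only [circularClique]; omega,
      by simp only [markedVoltage_second P (show 0 < D by omega)]⟩
  have hstep : ∀ i, γ (σ i) = γ i := fun i => marked_iso_eq hD hP (hm i) (hm (σ i)) (e₁ i).1
  have hconst : ∀ i, γ i = γ i₀ := by
    intro i
    obtain ⟨m, rfl⟩ := htrans i
    induction m with
    | zero => rfl
    | succ m ih => rw [Function.iterate_succ_apply', hstep, ih]
  refine ⟨γ i₀, φ, fun i x => by rw [hf, hconst], (hm i₀).1, (hm i₀).2, fun i => ?_, fun i => ?_⟩
  · have := (e₁ i).2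
    rwa [hconst i, hconst (σ i)] at this
  · have := (e₂ i).2
    rwa [hconst i, hconst (τ i)] at this

/-! ### Permutations without twisted intertwiners -/

/-- The permutation of `Fin (m + 9)` that rotates each of the three segments `{0, 1}`, `{2, 3, 4}`
and `{5, …, m + 8}`. -/
def segmentRotate (m : ℕ) : Equiv.Perm (Fin (m + 9)) where
  toFun x := ⟨if (x : ℕ) = 1 then 0 else if (x : ℕ) = 4 then 2 else if (x : ℕ) = m + 8 then 5
    else x + 1, by have := x.2; split_ifs <;> omega⟩
  invFun x := ⟨if (x : ℕ) = 0 then 1 else if (x : ℕ) = 2 then 4 else if (x : ℕ) = 5 then m + 8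
    else x - 1, by have := x.2; split_ifs <;> omega⟩
  left_inv x := by
    have := x.2
    ext
    grind
  right_inv x := by
    have := x.2
    ext
    grind

theorem segmentRotate_val {m : ℕ} (x : Fin (m + 9)) :
    ((x : ℕ) = 1 ∧ (segmentRotate m x : ℕ) = 0) ∨ ((x : ℕ) = 4 ∧ (segmentRotate m x : ℕ) = 2) ∨
      ((x : ℕ) = m + 8 ∧ (segmentRotate m x : ℕ) = 5) ∨
      ((x : ℕ) ≠ 1 ∧ (x : ℕ) ≠ 4 ∧ (x : ℕ) ≠ m + 8 ∧ (segmentRotate m x : ℕ) = x + 1) := by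
  simp only [segmentRotate, Equiv.coe_fn_mk]
  split_ifs <;> omega

theorem finRotate_val {m : ℕ} (x : Fin (m + 9)) :
    ((x : ℕ) = m + 8 ∧ (finRotate (m + 9) x : ℕ) = 0) ∨
      ((x : ℕ) ≠ m + 8 ∧ (finRotate (m + 9) x : ℕ) = x + 1) := by
  rw [coe_finRotate]
  simp only [Fin.ext_iff, Fin.val_last]
  split_ifs <;> omega

theorem finRotate_ne {m : ℕ} (x : Fin (m + 9)) : finRotate (m + 9) x ≠ x := fun h => by
  have := finRotate_val x
  rw [h] at this
  omega

theorem segmentRotate_ne {m : ℕ} (x : Fin (m + 9)) : segmentRotate m x ≠ x := fun h => by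
  have := segmentRotate_val x
  rw [h] at this
  omega

theorem finRotate_eq {m a : ℕ} (h : a + 1 < m + 9) :
    finRotate (m + 9) ⟨a, by omega⟩ = ⟨a + 1, h⟩ := by
  have := finRotate_val (m := m) ⟨a, by omega⟩
  ext
  simp only at *
  omega

theorem finRotate_iterate_zero {m : ℕ} (x : Fin (m + 9)) :
    ∃ j : ℕ, (finRotate (m + 9))^[j] 0 = x := by
  have key : ∀ a (h : a < m + 9), (finRotate (m + 9))^[a] 0 = ⟨a, h⟩ := by
    intro a
    induction a with
    | zero => exact fun _ => rfl
    | succ a ih =>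
      intro h
      rw [Function.iterate_succ_apply', ih (by omega), finRotate_eq]
  exact ⟨x, key x x.2⟩

section
variable {m m' : ℕ} (φ : Fin (m + 9) → Fin (m' + 9))

theorem segmentRotate_values (m : ℕ) :
    segmentRotate m ⟨0, by omega⟩ = ⟨1, by omega⟩ ∧ segmentRotate m ⟨1, by omega⟩ = ⟨0, by omega⟩ ∧
    segmentRotate m ⟨2, by omega⟩ = ⟨3, by omega⟩ ∧ segmentRotate m ⟨3, by omega⟩ = ⟨4, by omega⟩ ∧
    segmentRotate m ⟨4, by omega⟩ = ⟨2, by omega⟩ :=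
  ⟨rfl, rfl, rfl, rfl, rfl⟩

/-- `segmentRotate` has an orbit of size two, while no power of `finRotate` below the order has a
fixed point. -/
theorem not_equivariant_segmentRotate_finRotate
    (h : (∀ i, φ (segmentRotate m i) = finRotate _ (φ i)) ∨
      (∀ i, φ (segmentRotate m i) = (finRotate _)⁻¹ (φ i))) : False := by
  obtain ⟨t₀, t₁, -⟩ := segmentRotate_values m
  rcases h with h | h
  · have h₀ := h ⟨0, by omega⟩
    have h₁ := h ⟨1, by omega⟩
    rw [t₀] at h₀
    rw [t₁, h₀] at h₁
    have e₁ := finRotate_val (φ ⟨0, by omega⟩)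
    have e₂ := finRotate_val (finRotate _ (φ ⟨0, by omega⟩))
    rw [← h₁] at e₂
    omega
  · have h₀ := h ⟨0, by omega⟩
    have h₁ := h ⟨1, by omega⟩
    rw [t₀, Equiv.Perm.eq_inv_iff_eq] at h₀
    rw [t₁, Equiv.Perm.eq_inv_iff_eq] at h₁
    have e₁ := finRotate_val (φ ⟨0, by omega⟩)
    have e₂ := finRotate_val (φ ⟨1, by omega⟩)
    rw [h₁] at e₁
    rw [h₀] at e₂
    omega

/-- The cyclic sequence of segments of lengths two, three and at least four has no reflection
symmetry: `φ` would have to swap `0` and `1`, hence map `{2, 3, 4}` to the end of the long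
segment. -/
theorem not_equivariant_finRotate_inv
    (h : ∀ i, φ (finRotate _ i) = (finRotate _)⁻¹ (φ i))
    (h' : (∀ i, φ (segmentRotate m i) = segmentRotate _ (φ i)) ∨
      (∀ i, φ (segmentRotate m i) = (segmentRotate _)⁻¹ (φ i))) : False := by
  simp only [Equiv.Perm.eq_inv_iff_eq] at h h'
  obtain ⟨t₀, t₁, t₂, t₃, t₄⟩ := segmentRotate_values m
  have s₀ := h ⟨0, by omega⟩
  have s₁ := h ⟨1, by omega⟩
  have s₂ := h ⟨2, by omega⟩
  have s₃ := h ⟨3, by omega⟩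
  rw [finRotate_eq (a := 0) (by omega)] at s₀
  rw [finRotate_eq (a := 1) (by omega)] at s₁
  rw [finRotate_eq (a := 2) (by omega)] at s₂
  rw [finRotate_eq (a := 3) (by omega)] at s₃
  have v₁ := finRotate_val (φ ⟨0 + 1, by omega⟩)
  have v₂ := finRotate_val (φ ⟨1 + 1, by omega⟩)
  have v₃ := finRotate_val (φ ⟨2 + 1, by omega⟩)
  have v₄ := finRotate_val (φ ⟨3 + 1, by omega⟩)
  rw [s₀] at v₁
  rw [s₁] at v₂
  rw [s₂] at v₃
  rw [s₃] at v₄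
  simp only [Nat.reduceAdd, zero_add] at v₁ v₂ v₃ v₄
  have w₀ := segmentRotate_val (φ ⟨0, by omega⟩)
  have w₁ := segmentRotate_val (φ ⟨1, by omega⟩)
  have w₂ := segmentRotate_val (φ ⟨2, by omega⟩)
  rcases h' with h' | h'
  · rw [← h', t₀] at w₀
    rw [← h', t₁] at w₁
    rw [← h', t₂] at w₂
    omega
  · have a₀ := h' ⟨1, by omega⟩
    have a₁ := h' ⟨0, by omega⟩
    have a₂ := h' ⟨4, by omega⟩
    rw [t₁] at a₀
    rw [t₀] at a₁
    rw [t₄] at a₂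
    rw [a₀] at w₀
    rw [a₁] at w₁
    rw [a₂] at w₂
    omega

/-- An equivariant map fixes the segment `{0, 1}` pointwise, hence is reduction modulo `m' + 9`; if
it were not injective, it would map another part of the long segment to `{0, 1}`. -/
theorem equivariant_eq
    (h : ∀ i, φ (finRotate _ i) = finRotate _ (φ i))
    (h' : (∀ i, φ (segmentRotate m i) = segmentRotate _ (φ i)) ∨
      (∀ i, φ (segmentRotate m i) = (segmentRotate _)⁻¹ (φ i))) :
    m = m' ∧ ∀ i, (φ i : ℕ) = i := by
  simp only [Equiv.Perm.eq_inv_iff_eq] at h'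
  obtain ⟨t₀, t₁, -⟩ := segmentRotate_values m
  have hz : (φ ⟨0, by omega⟩ : ℕ) = 0 := by
    have s₀ := h ⟨0, by omega⟩
    rw [finRotate_eq (a := 0) (by omega)] at s₀
    have v₀ := finRotate_val (φ ⟨0, by omega⟩)
    rw [← s₀] at v₀
    simp only [zero_add] at v₀
    have w₀ := segmentRotate_val (φ ⟨0, by omega⟩)
    have w₁ := segmentRotate_val (φ ⟨1, by omega⟩)
    rcases h' with h' | h'
    · rw [← h', t₀] at w₀
      rw [← h', t₁] at w₁
      omega
    · have a₀ := h' ⟨1, by omega⟩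
      have a₁ := h' ⟨0, by omega⟩
      rw [t₁] at a₀
      rw [t₀] at a₁
      rw [a₀] at w₀
      rw [a₁] at w₁
      omega
  have hs : ∀ a (ha : a + 1 < m + 9),
      ((φ ⟨a, by omega⟩ : ℕ) = m' + 8 ∧ (φ ⟨a + 1, ha⟩ : ℕ) = 0) ∨
      ((φ ⟨a, by omega⟩ : ℕ) ≠ m' + 8 ∧ (φ ⟨a + 1, ha⟩ : ℕ) = φ ⟨a, by omega⟩ + 1) := by
    intro a ha
    rw [← finRotate_eq ha, h]
    exact finRotate_val _
  have hid : ∀ a (ha : a < m + 9), a < m' + 9 → (φ ⟨a, ha⟩ : ℕ) = a := by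
    intro a
    induction a with
    | zero => exact fun _ _ => hz
    | succ a ih =>
      intro ha ha'
      have := ih (by omega) (by omega)
      have := hs a ha
      omega
  -- The successor of the last index is `0`, where `φ` takes the value `0`.
  have hlast : ((φ ⟨m + 8, by omega⟩ : ℕ) = m' + 8) := by
    have e := h ⟨m + 8, by omega⟩
    have e' : finRotate (m + 9) ⟨m + 8, by omega⟩ = ⟨0, by omega⟩ := by
      have := finRotate_val (m := m) ⟨m + 8, by omega⟩
      ext
      simp only at *
      omega
    rw [e'] at e
    have := finRotate_val (φ ⟨m + 8, by omega⟩)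
    rw [← e] at this
    omega
  have hmm : m = m' := by
    rcases lt_trichotomy m m' with hlt | heq | hgt
    · have := hid (m + 8) (by omega) (by omega)
      omega
    · exact heq
    · exfalso
      -- Otherwise `φ` maps `m' + 10`, an index in the long segment, to `1`, but the index following
      -- it in its segment neither to the successor nor to the predecessor of `1` in `{0, 1}`.
      have c₀ := hid (m' + 8) (by omega) (by omega)
      have c₁ := hs (m' + 8) (by omega)
      have hne : m ≠ m' + 1 := by
        rintro rfl
        have : m' + 8 + 1 = m' + 1 + 8 := by omega
        simp only [this] at c₁
        omega
      have c₂ := hs (m' + 8 + 1) (by omega)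
      have f₅ := hid 5 (by omega) (by omega)
      have v := segmentRotate_val (m := m) ⟨m' + 8 + 1 + 1, by omega⟩
      have key : (φ (segmentRotate m ⟨m' + 8 + 1 + 1, by omega⟩) : ℕ) = 2 ∨
          (φ (segmentRotate m ⟨m' + 8 + 1 + 1, by omega⟩) : ℕ) = 5 := by
        by_cases hm : m' + 8 + 1 + 1 = m + 8
        · have : segmentRotate m ⟨m' + 8 + 1 + 1, by omega⟩ = ⟨5, by omega⟩ := by
            ext
            simp only at v ⊢
            omega
          rw [this]
          omega
        · have : segmentRotate m ⟨m' + 8 + 1 + 1, by omega⟩ = ⟨m' + 8 + 1 + 1 + 1, by omega⟩ := by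
            ext
            simp only at v ⊢
            omega
          rw [this]
          have := hs (m' + 8 + 1 + 1) (by omega)
          omega
      rcases h' with h' | h'
      · have w := segmentRotate_val (φ ⟨m' + 8 + 1 + 1, by omega⟩)
        rw [← h'] at w
        omega
      · have w := segmentRotate_val (φ (segmentRotate m ⟨m' + 8 + 1 + 1, by omega⟩))
        rw [h'] at w
        omega
  exact ⟨hmm, fun i => hid i i.2 (hmm ▸ i.2)⟩

end

/-! ### The rigid family -/

theorem marked_iso_eq_id (hD : 2 ≤ D) (hP : 2 * D ≤ P)
    {γ : circularClique P D ≃g circularClique P D} (h0 : (γ ⟨0, by omega⟩ : ℕ) = 0)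
    (h1 : (γ ⟨P + 2, by omega⟩ : ℕ) = P + 2)
    (h2 : IsMarkedEdge P D (γ ⟨D, by omega⟩) (γ ⟨D + P + 2, by omega⟩)) (x) : γ x = x := by
  have hx := x.2
  have hgx := (γ x).2
  obtain ⟨t, ht, h⟩ := circularClique_iso_eq hD hP γ
  rcases h with h | h
  · have := h ⟨0, by omega⟩
    have := h x
    ext
    simp only at *
    omega
  · exfalso
    have a := h ⟨0, by omega⟩
    have b := h ⟨P + 2, by omega⟩
    have c := h ⟨D, by omega⟩
    unfold IsMarkedEdge at h2
    simp only at *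
    omega

/-- The cover of the circular clique with `m + 9` sheets and voltages `finRotate` and
`segmentRotate`. -/
def rigidLift (P D m : ℕ) : SimpleGraph (Fin (m + 9) × Fin (2 * P + D + 2)) :=
  markedLift P D (finRotate (m + 9)) (segmentRotate m)

/-- The only homomorphisms between the covers are the identities. -/
theorem rigidLift_hom (hD : 2 ≤ D) (hP : 2 * D ≤ P) {k : ℕ} (hk : P = k * D) {m m' : ℕ}
    (f : rigidLift P D m →g rigidLift P D m') :
    m = m' ∧ ∀ p, ((f p).1 : ℕ) = p.1 ∧ (f p).2 = p.2 := by
  obtain ⟨γ, φ, hf, hm₁, hm₂, hσ, hτ⟩ := markedLift_hom_eq hD hP hk finRotate_ne segmentRotate_ne 0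
    finRotate_iterate_zero f
  have n₁ : (γ ⟨D, by omega⟩ : ℕ) ≠ γ ⟨0, by omega⟩ := fun h => by
    have := congrArg Fin.val (γ.injective (Fin.ext h))
    simp only at this
    omega
  have n₂ : (γ ⟨D, by omega⟩ : ℕ) ≠ γ ⟨P + 2, by omega⟩ := fun h => by
    have := congrArg Fin.val (γ.injective (Fin.ext h))
    simp only at this
    omega
  have v₁ := markedVoltage_first P D (finRotate (m' + 9)) (segmentRotate m')
  have v₂ := markedVoltage_second P (show 0 < D by omega) (finRotate (m' + 9)) (segmentRotate m')
  have v₁' := markedVoltage_swap P D (finRotate (m' + 9)) (segmentRotate m') 0 (P + 2)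
  have v₂' := markedVoltage_swap P D (finRotate (m' + 9)) (segmentRotate m') D (D + P + 2)
  rw [v₁] at v₁'
  rw [v₂] at v₂'
  -- The second marked edge cannot be mapped to the first.
  have hswap : ∀ a b, IsMarkedEdge P D a b → (a = 0 ∨ a = P + 2) →
      (∀ i, φ (segmentRotate m i) =
        markedVoltage P D (finRotate (m' + 9)) (segmentRotate m') a b (φ i)) → False := by
    intro a b hab ha h
    apply not_equivariant_segmentRotate_finRotate φ
    have : (a = 0 ∧ b = P + 2) ∨ (a = P + 2 ∧ b = 0) := by unfold IsMarkedEdge at hab; omega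
    rcases this with ⟨rfl, rfl⟩ | ⟨rfl, rfl⟩
    · exact Or.inl (by simpa only [v₁] using h)
    · exact Or.inr (by simpa only [v₁'] using h)
  have hD' : (γ ⟨D, by omega⟩ : ℕ) = D ∧ (γ ⟨D + P + 2, by omega⟩ : ℕ) = D + P + 2 ∨
      (γ ⟨D, by omega⟩ : ℕ) = D + P + 2 ∧ (γ ⟨D + P + 2, by omega⟩ : ℕ) = D := by
    rcases hm₂ with h | h | h | h
    · exact (hswap _ _ (Or.inl h) (Or.inl h.1) hτ).elim
    · exact (hswap _ _ (Or.inr (Or.inl h)) (Or.inr h.1) hτ).elim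
    · exact Or.inl h
    · exact Or.inr h
  have h0 : (γ ⟨0, by omega⟩ : ℕ) = 0 ∧ (γ ⟨P + 2, by omega⟩ : ℕ) = P + 2 ∨
      (γ ⟨0, by omega⟩ : ℕ) = P + 2 ∧ (γ ⟨P + 2, by omega⟩ : ℕ) = 0 := by
    rcases hm₁ with h | h | h | h
    · exact Or.inl h
    · exact Or.inr h
    · omega
    · omega
  have hτ' : (∀ i, φ (segmentRotate m i) = segmentRotate _ (φ i)) ∨
      (∀ i, φ (segmentRotate m i) = (segmentRotate _)⁻¹ (φ i)) := by
    rcases hD' with h | h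
    · exact Or.inl (by simpa only [h.1, h.2, v₂] using hτ)
    · exact Or.inr (by simpa only [h.1, h.2, v₂'] using hτ)
  rcases h0 with h | h
  · simp only [h.1, h.2, v₁] at hσ
    obtain ⟨hmm, hφ⟩ := equivariant_eq φ hσ hτ'
    refine ⟨hmm, fun p => ?_⟩
    rw [show f p = (φ p.1, γ p.2) from hf p.1 p.2]
    exact ⟨hφ p.1, marked_iso_eq_id hD hP h.1 h.2 hm₂ p.2⟩
  · simp only [h.1, h.2, v₁'] at hσ
    exact (not_equivariant_finRotate_inv φ hσ hτ').elim

theorem exists_unmarkedClique_closedWalk (hD : 2 ≤ D) (hP : 2 * D ≤ P) {k : ℕ} (hk : P = k * D) :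
    ∃ (v : Fin (2 * P + D + 2)) (w : (unmarkedClique P D).Walk v v), w.length = 2 * k + 3 := by
  obtain ⟨z, h₁, h₂⟩ := exists_unmarkedClique_adj_adj hD hP (⟨0, by omega⟩ : Fin (2 * P + D + 2))
    ⟨D, by omega⟩ le_rfl (Or.inl (by simp only; omega))
  obtain ⟨w, hw⟩ := exists_unmarkedClique_walk_odd hD hP hk
    (x := ⟨D, by omega⟩) (y := ⟨0, by omega⟩) (by simp only [ne_eq, Fin.mk.injEq]; omega)
  exact ⟨_, .cons h₁ (.cons h₂ w), by simp only [Walk.length_cons]; omega⟩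

/-- The inclusion of the unmarked circular clique as the copy with index `0`. -/
def rigidLiftBlock (P D m : ℕ) : unmarkedClique P D →g rigidLift P D m where
  toFun x := (0, x)
  map_rel' h := ⟨h.1, by simp [markedVoltage_eq_one h.2]⟩

/-- The covering projection onto the circular clique. -/
def rigidLiftProj (P D m : ℕ) : rigidLift P D m →g circularClique P D :=
  voltageLiftProj _ _ _

theorem oddGirth_eq_of_iso_rigidLift (hD : 2 ≤ D) (hP : 2 * D ≤ P) {k : ℕ} (hk : P = k * D) {m : ℕ}
    {V : Type*} {H : SimpleGraph V} (e : rigidLift P D m ≃g H) :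
    H.oddGirth = (2 * k + 3 : ℕ) := by
  obtain ⟨v, w, hw⟩ := exists_unmarkedClique_closedWalk hD hP hk
  refine oddGirth_eq_of_closedWalk ⟨k + 1, by ring⟩ (fun v w hw => ?_)
    ((w.map (rigidLiftBlock P D m)).map e.toHom) (by simp only [Walk.length_map, hw])
  have := circularClique_le_length hk _
    ((w.map e.symm.toHom).map (rigidLiftProj P D m))
    (by simpa only [Walk.length_map] using hw)
  simpa only [Walk.length_map] using this

theorem isRegularOfDegree_of_iso_rigidLift {m : ℕ} {V : Type*} {H : SimpleGraph V}
    [H.LocallyFinite] (e : rigidLift P D m ≃g H) : H.IsRegularOfDegree (D + 1) := by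
  rw [isRegularOfDegree_iff_natCard]
  intro v
  rw [Nat.card_congr (e.symm.mapNeighborSet v), ← natCard_circularClique_neighborSet (e.symm v).2]
  exact Nat.card_congr (voltageLiftNeighborEquiv (circularClique P D)
    (fun x y => markedVoltage P D (finRotate (m + 9)) (segmentRotate m) x y)
    (fun x y => markedVoltage_swap P D _ _ x y) (e.symm v))

end SimpleGraph

theorem theorem2 (d g : ℕ) (hd : 3 ≤ d) (hg : 7 ≤ g) (hg_odd : Odd g) :
    ∃ (n : ℕ → ℕ) (G : ∀ i : ℕ, SimpleGraph (Fin (n i))) (_ : ∀ i, (G i).LocallyFinite),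
      SimpleGraph.MutuallyRigid G ∧
      ∀ i, (G i).IsRegularOfDegree d ∧ (G i).oddGirth = (g : ℕ∞) := by
  obtain ⟨D, rfl⟩ : ∃ D, d = D + 1 := ⟨d - 1, by omega⟩
  obtain ⟨k, rfl⟩ : ∃ k, g = 2 * k + 3 := by
    obtain ⟨j, rfl⟩ := hg_odd
    exact ⟨j - 1, by omega⟩
  obtain ⟨P, hk⟩ : ∃ P, P = k * D := ⟨_, rfl⟩
  have hD : 2 ≤ D := by omega
  have hP : 2 * D ≤ P := hk ▸ Nat.mul_le_mul_right D (by omega)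
  have hcard : ∀ i : ℕ, Fintype.card (Fin (i + 9) × Fin (2 * P + D + 2)) =
      (i + 9) * (2 * P + D + 2) := fun i => by simp
  let e := fun i => (SimpleGraph.rigidLift P D i).overFinIso (hcard i)
  let inst : ∀ i, ((SimpleGraph.rigidLift P D i).overFin (hcard i)).LocallyFinite :=
    fun i v => Fintype.ofFinite _
  refine ⟨_, fun i => (SimpleGraph.rigidLift P D i).overFin (hcard i), inst,
    ⟨fun i f => ?_, fun i j hij => ⟨fun f => ?_⟩⟩, fun i => ⟨?_, ?_⟩⟩
  · have h := (SimpleGraph.rigidLift_hom hD hP hk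
      ((e i).symm.toHom.comp (f.comp (e i).toHom))).2
    ext x : 1
    have hx := h ((e i).symm x)
    have : (e i).symm (f (e i ((e i).symm x))) = (e i).symm x :=
      Prod.ext (Fin.ext hx.1) hx.2
    rw [RelIso.apply_symm_apply] at this
    exact (e i).symm.injective this
  · exact hij (SimpleGraph.rigidLift_hom hD hP hk
      ((e j).symm.toHom.comp (f.comp (e i).toHom))).1
  · exact SimpleGraph.isRegularOfDegree_of_iso_rigidLift (e i)
  · exact SimpleGraph.oddGirth_eq_of_iso_rigidLift hD hP hk (e i)
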